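/- Let $(V,\mathcal B)$ be an even-replicate $S(2,3,v)$: $V$ is a set of $v\ge 1$ points, $\mathcal B$ is a set of $3$-element subsets (blocks) of $V$, any two distinct points lie together in exactly one block, and every point lies in an even number of blocks. Let $H\in\mathbb F_2^{v\times b}$, $b=\frac{v(v-1)}{6}$, be its point-by-block incidence matrix, suppose that the binary linear code $\{c\in\mathbb F_2^b : Hc^T=0\}$ has minimum distance $d$, and put $$H'=\begin{bmatrix} I_v & H\\ 1\cdots 1 & 0\cdots 0\end{bmatrix}\in\mathbb F_2^{(v+1)\times n},\qquad n=v+b .$$ Consider the entanglement-assisted quantum error-correcting code $\mathcal C$ formed by the quantum parity-check matrix $\begin{bmatrix}\omega H'\\ \bar\omega H'\end{bmatrix}$. That is, take the Pauli operators $X^{r}$ and $Z^{r}$ on $n$ noisy qubits, for the rows $r$ of $H'$. Extend each of them by a Pauli operator on $c$ noiseless qubits (the receiver's halves of $c=\operatorname{rank}_{\mathbb F_2}(H'H'^T)$ ebits) to Hermitian Pauli operators that commute pairwise and generate a group not containing $-1$. The code space of $\mathcal C$ is the simultaneous $+1$ eigenspace of the extended operators. A Pauli error $E$ on the $n$ noisy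 qubits is undetectable if $E\otimes I$ maps the code space into itself, and acts trivially if $E\otimes I$ is a scalar on the code space. The distance of $\mathcal C$ is the smallest weight of an undetectable Pauli error that does not act trivially. A code of distance $\delta$ is degenerate if some Pauli operator that is not a multiple of the identity and has weight less than $\delta$ acts trivially; otherwise it is non-degenerate. Then such codes $\mathcal C$ exist, and every such $\mathcal C$ has distance at most $d$. If the distance of $\mathcal C$ equals $d$, then $\mathcal C$ is non-degenerate, except possibly when $v=21$, $33$ or $45$. -/

import Mathlib

open scoped Matrix

/-! ### Combinatorial designs -/

/-- `(V, 𝓑)` is a pairwise balanced design of index 1 with block sizes from `K`: `V` is a nonempty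
finite set, any two distinct points lie together in exactly one block, and every block has its
size in `K`. -/
structure IsPBD {V : Type*} [Fintype V] [DecidableEq V] (K : Set ℕ) (𝓑 : Finset (Finset V)) :
    Prop where
  nonempty : Nonempty V
  existsUnique_block : ∀ x y : V, x ≠ y → ∃! B : Finset V, B ∈ 𝓑 ∧ x ∈ B ∧ y ∈ B
  card_mem : ∀ B ∈ 𝓑, B.card ∈ K

/-- `(V, 𝓑)` is a Steiner 2-design `S(2, μ, v)` with `v = |V|`. -/
def IsSteiner2 {V : Type*} [Fintype V] [DecidableEq V] (μ : ℕ) (𝓑 : Finset (Finset V)) : Prop :=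
  IsPBD {μ} 𝓑

/-- Every point lies in an even number of blocks. -/
def IsEvenReplicate {V : Type*} [DecidableEq V] (𝓑 : Finset (Finset V)) : Prop :=
  ∀ x : V, Even (𝓑.filter (fun B => x ∈ B)).card

/-- The incidence matrix over `𝔽₂`: rows are indexed by points, columns by blocks. -/
def incidenceMatrix {V : Type*} [DecidableEq V] (𝓑 : Finset (Finset V)) :
    Matrix V 𝓑 (ZMod 2) :=
  Matrix.of fun x B => if x ∈ (B : Finset V) then 1 else 0

/-- The extended matrix `H' = [[I, H], [1 ⋯ 1, 0 ⋯ 0]]`. -/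
def extendedMatrix {V β : Type*} [DecidableEq V] (H : Matrix V β (ZMod 2)) :
    Matrix (V ⊕ Unit) (V ⊕ β) (ZMod 2) :=
  Matrix.fromBlocks 1 H (Matrix.of fun _ _ => 1) 0

/-! ### Classical linear codes -/

/-- The binary linear code that admits `H` as a parity-check matrix. -/
def codeOf {M N : Type*} [Fintype N] (H : Matrix M N (ZMod 2)) : Submodule (ZMod 2) (N → ZMod 2) :=
  LinearMap.ker H.mulVecLin

/-- The linear code `C` has minimum distance `d` (never true for the zero code). -/
def HasMinDist {N : Type*} [Fintype N] (C : Submodule (ZMod 2) (N → ZMod 2)) (d : ℕ) : Prop :=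
  IsLeast {w : ℕ | ∃ c ∈ C, c ≠ 0 ∧ hammingNorm c = w} d

/-! ### Pauli operators -/

/-- The Pauli group on the qubits indexed by `ι`, modulo global phases. The pair `(a, b)` stands
for `X^a Z^b`, and addition of pairs is multiplication of operators up to phase. -/
abbrev Pauli (ι : Type*) := (ι → ZMod 2) × (ι → ZMod 2)

/-- State vectors of the qubits indexed by `ι`, as amplitudes in the computational basis. -/
abbrev QState (ι : Type*) := (ι → ZMod 2) → ℂ

/-- The operator `X^a Z^b`, which sends the basis state `|x⟩` to `(-1)^(b · x) |x + a⟩`. -/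
def pauliOp {ι : Type*} [Fintype ι] (p : Pauli ι) : Module.End ℂ (QState ι) where
  toFun ψ := fun y => (-1 : ℂ) ^ (p.2 ⬝ᵥ (y + p.1)).val * ψ (y + p.1)
  map_add' ψ φ := by
    funext y
    simp only [Pi.add_apply]
    ring
  map_smul' t ψ := by
    funext y
    simp only [Pi.smul_apply, smul_eq_mul, RingHom.id_apply]
    ring

/-- The number of qubits on which a Pauli operator is not a multiple of the identity. -/
def pauliWeight {ι : Type*} [Fintype ι] (p : Pauli ι) : ℕ :=
  (Finset.univ.filter (fun i => p.1 i ≠ 0 ∨ p.2 i ≠ 0)).card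

/-- The symplectic form: it is `0` if the two Pauli operators commute and `1` if they
anticommute. -/
def symp {ι : Type*} [Fintype ι] (p q : Pauli ι) : ZMod 2 := p.1 ⬝ᵥ q.2 + p.2 ⬝ᵥ q.1

/-- The Pauli operator `p ⊗ q` on two groups of qubits. -/
def Pauli.tensor {ι κ : Type*} (p : Pauli ι) (q : Pauli κ) : Pauli (ι ⊕ κ) :=
  (Sum.elim p.1 q.1, Sum.elim p.2 q.2)

/-! ### Entanglement-assisted stabilizer codes -/

/-- The Pauli operators given by the rows of the quantum parity-check matrix `[ω H; ω̄ H]`, under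
the identification `0 ↦ I`, `ω ↦ X`, `ω̄ ↦ Z`, `1 ↦ XZ` of `𝔽₄` with the Pauli operators on a
qubit modulo phases: the operators `X^r` and `Z^r` for the rows `r` of the binary matrix `H`. -/
def quantumCheckRows {M N : Type*} (H : Matrix M N (ZMod 2)) : M ⊕ M → Pauli N :=
  Sum.elim (fun i => (H i, 0)) (fun i => (0, H i))

/-- `Q` is the code space of an entanglement-assisted code formed by the (possibly noncommuting)
Pauli operators `g i` on the noisy qubits `N`, with `c` ebits. The `c` further qubits, indexed by
`Fin c`, are the receiver's noiseless halves of the ebits. Each `g i` is extended by a Pauli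
operator on these qubits to a Hermitian Pauli operator (with a phase that makes it an involution)
such that the extended operators commute; `Q` is their simultaneous `+1` eigenspace. The extended
stabilizer must not contain `-1`, that is, `Q` is nonzero. The number `c` is the required number of
ebits, half the rank of the commutation matrix of the `g i`. -/
structure IsEACode {κ N : Type*} [Fintype κ] [Fintype N] (g : κ → Pauli N) (c : ℕ)
    (Q : Submodule ℂ (QState (N ⊕ Fin c))) : Prop where
  ebits : (Matrix.of fun i j => symp (g i) (g j)).rank = 2 * c
  stabilized : ∃ (e : κ → Pauli (Fin c)) (phase : κ → ℂ) (s : κ → Module.End ℂ (QState (N ⊕ Fin c))),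
    (∀ i, s i = phase i • pauliOp ((g i).tensor (e i))) ∧
    (∀ i, s i * s i = 1) ∧
    (∀ i j, Commute (s i) (s j)) ∧
    Q = ⨅ i, (s i).eigenspace 1
  ne_bot : Q ≠ ⊥

/-- The action of an error on the noisy qubits; the ebits on the receiver's side are untouched. -/
def errorOp {N : Type*} [Fintype N] {c : ℕ} (E : Pauli N) :
    Module.End ℂ (QState (N ⊕ Fin c)) :=
  pauliOp (E.tensor 0)

/-- The error is undetectable: it maps encoded states to encoded states. -/
def Undetectable {N : Type*} [Fintype N] {c : ℕ} (Q : Submodule ℂ (QState (N ⊕ Fin c)))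
    (E : Pauli N) : Prop :=
  ∀ ψ ∈ Q, errorOp E ψ ∈ Q

/-- The error acts trivially on encoded states, that is, as a global phase. -/
def ActsTrivially {N : Type*} [Fintype N] {c : ℕ} (Q : Submodule ℂ (QState (N ⊕ Fin c)))
    (E : Pauli N) : Prop :=
  ∃ t : ℂ, ∀ ψ ∈ Q, errorOp E ψ = t • ψ

/-- The code has distance `δ`: this is the least weight of an undetectable Pauli error that acts
nontrivially on the encoded states. -/
def HasDistance {N : Type*} [Fintype N] {c : ℕ} (Q : Submodule ℂ (QState (N ⊕ Fin c)))
    (δ : ℕ) : Prop :=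
  IsLeast {w : ℕ | ∃ E : Pauli N, Undetectable Q E ∧ ¬ ActsTrivially Q E ∧ pauliWeight E = w} δ

/-- A code of distance `δ` is degenerate if some non-identity Pauli operator of weight smaller than
`δ` acts trivially on the encoded states. -/
def IsDegenerate {N : Type*} [Fintype N] {c : ℕ} (Q : Submodule ℂ (QState (N ⊕ Fin c))) : Prop :=
  ∃ δ : ℕ, HasDistance Q δ ∧ ∃ E : Pauli N, E ≠ 0 ∧ pauliWeight E < δ ∧ ActsTrivially Q E

/-!
The argument compares two quantities: the minimum distance `d` of the classical code of the
incidence matrix `H`, and the least weight of a Pauli operator that acts trivially.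

A Pauli operator that acts trivially on the code space is, up to phase, a product of the extended
check operators; otherwise a Pauli operator commuting with all of these and anticommuting with it
would act on the code space and force the scalar to be zero. Comparing commutators on the ebits, the
product also commutes with every check. As any two rows of `H'` have inner product `1` (replication
numbers are even, and two points share one block), the `X` part and the `Z` part are each a sum of
evenly many rows of `H'` (`IsSteiner2.exists_vecMul_of_actsTrivially`). Such a sum is given by a
set `S` of points. Its support consists of the points of `S` if `|S|` is even, or of the
complement of `S` if `|S|` is odd, together with the blocks that meet `S` in an odd number of
points.

Double counting incidences between points and these odd blocks bounds the weight of such a sum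
below by roughly `2 v / 3` (`IsSteiner2.le_card_add_card_oddBlocks`). On the other hand, the words
of the classical code supported on `v + 3` chosen blocks form a subcode of dimension at least
three, and the Plotkin bound gives `d ≤ 4 (v + 3) / 7` (`HasMinDist.seven_mul_le`). As `d` is
an integer, it never exceeds the lower bound, so every non-identity Pauli operator that acts
trivially has weight at least `d`. This rules out degeneracy if the distance is `d`.

For the bound on the distance, a word `w` of minimum weight of the classical code yields the
undetectable error `X^(0, w)`. It acts trivially only if `w` is the all-one word, which has weight
`b > d`. The code exists with one ebit: the indicator function of the span of the
extended rows is a common fixed vector of the extended check operators.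
-/

/-! ### An averaging bound for binary linear codes -/

section Plotkin

/-- At each coordinate at most half of the words of a binary linear code are nonzero. -/
lemma two_mul_card_filter_coord_ne_zero_le {A : Type*} (C : Submodule (ZMod 2) (A → ZMod 2))
    [Fintype C] (i : A) :
    2 * (Finset.univ.filter fun c : C => (c : A → ZMod 2) i ≠ 0).card ≤ Fintype.card C := by
  by_cases h : ∃ c₀ : C, (c₀ : A → ZMod 2) i ≠ 0
  · obtain ⟨c₀, hc₀⟩ := h
    have hle : (Finset.univ.filter fun c : C => (c : A → ZMod 2) i ≠ 0).card ≤
        (Finset.univ.filter fun c : C => ¬ (c : A → ZMod 2) i ≠ 0).card := by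
      refine Finset.card_le_card_of_injOn (fun c => c + c₀) (fun c hc => ?_)
        (fun a _ b _ hab => add_right_cancel hab)
      simp only [Finset.coe_filter, Finset.mem_univ, true_and, Set.mem_ofPred_eq] at hc ⊢
      rw [Submodule.coe_add, Pi.add_apply]
      have h : ∀ a b : ZMod 2, a ≠ 0 → b ≠ 0 → ¬ a + b ≠ 0 := by decide
      exact h _ _ hc hc₀
    have := Finset.card_filter_add_card_filter_not (s := (Finset.univ : Finset C))
      (fun c : C => (c : A → ZMod 2) i ≠ 0)
    rw [Finset.card_univ] at this
    omega
  · push Not at h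
    simp [h]

/-- The Plotkin bound: compare the average weight of a nonzero word with the minimum weight. -/
lemma two_mul_mul_card_sub_one_le {A : Type*} [Fintype A] (C : Submodule (ZMod 2) (A → ZMod 2))
    [Fintype C] {d : ℕ} (hd : ∀ c ∈ C, c ≠ 0 → d ≤ hammingNorm c) :
    2 * (d * (Fintype.card C - 1)) ≤ Fintype.card A * Fintype.card C := by
  classical
  have h1 : d * (Fintype.card C - 1) ≤ ∑ c : C, hammingNorm (c : A → ZMod 2) := by
    rw [← Finset.card_univ, ← Finset.card_erase_of_mem (Finset.mem_univ (0 : C)), mul_comm,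
      ← smul_eq_mul, ← Finset.sum_const]
    refine le_trans (Finset.sum_le_sum fun c hc => ?_)
      (Finset.sum_le_sum_of_subset (Finset.erase_subset 0 _))
    exact hd c c.2 fun h => Finset.ne_of_mem_erase hc (Subtype.ext h)
  have h2 : ∑ c : C, hammingNorm (c : A → ZMod 2) =
      ∑ i : A, (Finset.univ.filter fun c : C => (c : A → ZMod 2) i ≠ 0).card := by
    exact Finset.sum_card_bipartiteAbove_eq_sum_card_bipartiteBelow
      (s := (Finset.univ : Finset C)) (t := (Finset.univ : Finset A))
      (fun (c : C) i => (c : A → ZMod 2) i ≠ 0)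
  calc 2 * (d * (Fintype.card C - 1))
      ≤ 2 * ∑ i : A, (Finset.univ.filter fun c : C => (c : A → ZMod 2) i ≠ 0).card := by
        rw [← h2]
        exact Nat.mul_le_mul_left 2 h1
    _ = ∑ i : A, 2 * (Finset.univ.filter fun c : C => (c : A → ZMod 2) i ≠ 0).card :=
        Finset.mul_sum _ _ _
    _ ≤ ∑ _i : A, Fintype.card C :=
        Finset.sum_le_sum fun i _ => two_mul_card_filter_coord_ne_zero_le C i
    _ = Fintype.card A * Fintype.card C := by simp

/-- A code with a parity-check matrix of `m` rows and at least `m + 3` columns has minimum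
distance at most `4 (m + 3) / 7`: the words supported on `m + 3` fixed coordinates form a subcode
of dimension at least three, to which the Plotkin bound applies. -/
lemma HasMinDist.seven_mul_le {M N : Type*} [Fintype M] [Fintype N] {H : Matrix M N (ZMod 2)}
    {d : ℕ} (hd : HasMinDist (codeOf H) d) (hcard : Fintype.card M + 3 ≤ Fintype.card N) :
    7 * d ≤ 4 * (Fintype.card M + 3) := by
  classical
  obtain ⟨A, -, hA⟩ := Finset.exists_subset_card_eq
    (s := (Finset.univ : Finset N)) (n := Fintype.card M + 3) (by simpa using hcard)
  let H₀ : Matrix M A (ZMod 2) := H.submatrix id (↑)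
  have hC : ∀ c ∈ codeOf H₀, c ≠ 0 → d ≤ hammingNorm c := by
    intro c hc hc0
    let w : N → ZMod 2 := fun i => if h : i ∈ A then c ⟨i, h⟩ else 0
    have hwA : ∀ i : A, w i = c i := fun i => by simp [w]
    have hw0 : ∀ i, i ∉ A → w i = 0 := fun i hi => by simp [w, hi]
    have hw : w ∈ codeOf H := by
      rw [codeOf, LinearMap.mem_ker, Matrix.mulVecLin_apply] at hc ⊢
      rw [← hc]
      funext x
      simp only [Matrix.mulVec, dotProduct, H₀, Matrix.submatrix_apply, id]
      rw [← Finset.sum_subset (Finset.subset_univ A)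
        (fun i _ hi => by rw [hw0 i hi, mul_zero]), ← Finset.sum_coe_sort]
      exact Finset.sum_congr rfl fun i _ => by rw [hwA]
    have hne : w ≠ 0 := by
      intro h
      exact hc0 (funext fun i => by rw [← hwA, h]; rfl)
    refine (hd.2 ⟨w, hw, hne, rfl⟩).trans ?_
    refine Finset.card_le_card_of_injOn
      (fun i => if h : i ∈ A then ⟨i, h⟩ else Classical.choice (by
        obtain ⟨i, -⟩ := Function.ne_iff.1 hc0
        exact ⟨i⟩)) ?_ ?_
    · intro i hi
      have hi' : w i ≠ 0 := (Finset.mem_filter.1 hi).2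
      have hiA : i ∈ A := by
        by_contra h
        exact hi' (hw0 i h)
      have : c ⟨i, hiA⟩ ≠ 0 := by rw [← hwA]; exact hi'
      simp [hiA, this]
    · intro i hi j hj hij
      have hiA : i ∈ A := by
        by_contra h
        exact (Finset.mem_filter.1 hi).2 (hw0 i h)
      have hjA : j ∈ A := by
        by_contra h
        exact (Finset.mem_filter.1 hj).2 (hw0 j h)
      simpa [hiA, hjA] using hij
  have h8 : 8 ≤ Fintype.card (codeOf H₀) := by
    have h1 := LinearMap.finrank_range_add_finrank_ker H₀.mulVecLin
    have h2 := Submodule.finrank_le (LinearMap.range H₀.mulVecLin)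
    rw [Module.finrank_fintype_fun_eq_card] at h1 h2
    rw [Fintype.card_coe, hA] at h1
    have h3 : 3 ≤ Module.finrank (ZMod 2) (codeOf H₀) := by
      rw [codeOf]
      omega
    rw [Module.card_eq_pow_finrank (K := ZMod 2), ZMod.card]
    exact Nat.pow_le_pow_right (n := 2) two_pos h3
  have h := two_mul_mul_card_sub_one_le _ hC
  rw [Fintype.card_coe, hA] at h
  generalize Fintype.card (codeOf H₀) = q at h h8
  obtain ⟨p, rfl⟩ := Nat.exists_eq_add_of_le h8
  rw [show 8 + p - 1 = 7 + p by omega] at h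
  nlinarith

end Plotkin

/-! ### Steiner triple systems of even replication number -/

section TripleSystem

variable {V : Type*} [Fintype V] [DecidableEq V] {𝓑 : Finset (Finset V)}

lemma IsSteiner2.card_filter_mem_mem {μ : ℕ} (hS : IsSteiner2 μ 𝓑) {x y : V} (hxy : x ≠ y) :
    (𝓑.filter (fun B => x ∈ B ∧ y ∈ B)).card = 1 := by
  obtain ⟨B, hB, huniq⟩ := hS.existsUnique_block x y hxy
  refine Finset.card_eq_one.2 ⟨B, ?_⟩
  ext C
  simp only [Finset.mem_filter, Finset.mem_singleton]
  exact ⟨fun h => huniq C h, fun h => h ▸ hB⟩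

lemma IsSteiner2.two_mul_replication_add_one (hS : IsSteiner2 3 𝓑) (x : V) :
    2 * (𝓑.filter (fun B => x ∈ B)).card + 1 = Fintype.card V := by
  have h := Finset.card_mul_eq_card_mul (s := Finset.univ.erase x)
    (t := 𝓑.filter (fun B => x ∈ B)) (m := 1) (n := 2) (fun y B => y ∈ B) ?_ ?_
  · rw [Finset.card_erase_of_mem (Finset.mem_univ x), Finset.card_univ] at h
    have : 0 < Fintype.card V := Fintype.card_pos_iff.2 ⟨x⟩
    omega
  · intro y hy
    rw [Finset.bipartiteAbove, Finset.filter_filter]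
    exact hS.card_filter_mem_mem (Finset.ne_of_mem_erase hy).symm
  · intro B hB
    rw [Finset.mem_filter] at hB
    have : Finset.bipartiteBelow (fun y B => y ∈ B) (Finset.univ.erase x) B = B.erase x := by
      ext y
      simp [Finset.bipartiteBelow]
    rw [this, Finset.card_erase_of_mem hB.2, show B.card = 3 from hS.card_mem B hB.1]

/-- Apart from the trivial system on one point, an even-replicate Steiner triple system has
replication number at least four (the number two would need `10 / 3` blocks); in particular it has
many more blocks than points. -/
lemma IsSteiner2.exists_replication (hS : IsSteiner2 3 𝓑) (hEven : IsEvenReplicate 𝓑)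
    (hne : 𝓑.Nonempty) :
    ∃ r, Even r ∧ 4 ≤ r ∧ Fintype.card V = 2 * r + 1 ∧ Fintype.card V + 3 ≤ 𝓑.card ∧
      ∀ x : V, (𝓑.filter (fun B => x ∈ B)).card = r := by
  obtain ⟨x₀⟩ := hS.nonempty
  have hr : ∀ x : V,
      (𝓑.filter (fun B => x ∈ B)).card = (𝓑.filter (fun B => x₀ ∈ B)).card := by
    intro x
    have h1 := hS.two_mul_replication_add_one x
    have h2 := hS.two_mul_replication_add_one x₀
    omega
  have hev := hEven x₀
  have hv := hS.two_mul_replication_add_one x₀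
  generalize (𝓑.filter (fun B => x₀ ∈ B)).card = r at hr hev hv
  have hb : Fintype.card V * r = 𝓑.card * 3 := by
    rw [← Finset.card_univ]
    refine Finset.card_mul_eq_card_mul (fun x B => x ∈ B) (fun x _ => hr x) fun B hB => ?_
    have : Finset.bipartiteBelow (fun y B => y ∈ B) Finset.univ B = B := by
      ext y
      simp [Finset.bipartiteBelow]
    rw [this]
    exact hS.card_mem B hB
  have hpos := hne.card_pos
  have h4 : 4 ≤ r := by
    by_contra! hlt
    obtain ⟨m, rfl⟩ := hev
    have hm : m < 2 := by omega
    rw [← hv] at hb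
    interval_cases m <;> omega
  refine ⟨r, hev, h4, hv.symm, ?_, hr⟩
  rw [← hv] at hb ⊢
  nlinarith

/-- The blocks that meet `S` in an odd number of points. -/
def oddBlocks (𝓑 : Finset (Finset V)) (S : Finset V) : Finset (Finset V) :=
  𝓑.filter fun B => Odd (B ∩ S).card

/-- The blocks through `x` that meet a set `Y` not containing `x` number at most `|Y|`, as each
point of `Y` is joined to `x` by one block. -/
lemma IsSteiner2.replication_sub_le {μ : ℕ} (hS : IsSteiner2 μ 𝓑) {x : V} {Y : Finset V}
    (hx : x ∉ Y) :
    (𝓑.filter (fun B => x ∈ B)).card - Y.card ≤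
      (𝓑.filter (fun B => x ∈ B ∧ Disjoint B Y)).card := by
  have h1 : (𝓑.filter (fun B => x ∈ B ∧ ¬ Disjoint B Y)).card ≤ Y.card := by
    have h := Finset.card_mul_le_card_mul (s := 𝓑.filter (fun B => x ∈ B ∧ ¬ Disjoint B Y))
      (t := Y) (m := 1) (n := 1) (fun B y => y ∈ B) ?_ ?_
    · simpa using h
    · intro B hB
      rw [Finset.mem_filter, Finset.not_disjoint_iff] at hB
      obtain ⟨y, hyB, hyY⟩ := hB.2.2
      exact Finset.card_pos.2 ⟨y, by simp [Finset.bipartiteAbove, hyB, hyY]⟩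
    · intro y hy
      rw [← hS.card_filter_mem_mem (x := x) (y := y) (by rintro rfl; exact hx hy)]
      refine Finset.card_le_card fun B hB => ?_
      simp only [Finset.bipartiteBelow, Finset.mem_filter] at hB ⊢
      exact ⟨hB.1.1, hB.1.2.1, hB.2⟩
  have h2 : (𝓑.filter (fun B => x ∈ B)).card =
      (𝓑.filter (fun B => x ∈ B ∧ Disjoint B Y)).card +
        (𝓑.filter (fun B => x ∈ B ∧ ¬ Disjoint B Y)).card := by
    rw [← Finset.card_filter_add_card_filter_not (s := 𝓑.filter (fun B => x ∈ B))
      (fun B => Disjoint B Y), Finset.filter_filter, Finset.filter_filter]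
  omega

/-- If `x ∈ S` and `|S|` is even, or `x ∉ S` and `|S|` is odd, then `x` lies in an odd block: the
blocks through `x` partition `S \ {x}`, so that otherwise `|S \ {x}|` would be even. -/
lemma IsSteiner2.exists_mem_oddBlocks {μ : ℕ} (hS : IsSteiner2 μ 𝓑) (hEven : IsEvenReplicate 𝓑)
    {S : Finset V} {x : V} (hx : x ∈ S ↔ Even S.card) : ∃ B ∈ oddBlocks 𝓑 S, x ∈ B := by
  by_contra! hcon
  have hall : ∀ B ∈ 𝓑.filter (fun B => x ∈ B), Even (B ∩ S).card := by
    intro B hB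
    rw [Finset.mem_filter] at hB
    by_contra hodd
    exact hcon B (by simp [oddBlocks, hB.1, Nat.not_even_iff_odd.1 hodd]) hB.2
  have hsum : ∑ B ∈ 𝓑.filter (fun B => x ∈ B), (B ∩ S.erase x).card = (S.erase x).card := by
    have h := Finset.sum_card_bipartiteAbove_eq_sum_card_bipartiteBelow
      (s := 𝓑.filter (fun B => x ∈ B)) (t := S.erase x) (fun B y => y ∈ B)
    rw [Finset.card_eq_sum_ones]
    convert h using 1
    · refine Finset.sum_congr rfl fun B _ => ?_
      congr 1
      ext y
      simp [Finset.bipartiteAbove, and_comm]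
    · refine Finset.sum_congr rfl fun y hy => ?_
      rw [Finset.bipartiteBelow, Finset.filter_filter,
        hS.card_filter_mem_mem (Finset.ne_of_mem_erase hy).symm]
  by_cases hxS : x ∈ S
  · have hodd : Odd (S.erase x).card := by
      have := hx.1 hxS
      have h0 : 0 < S.card := Finset.card_pos.2 ⟨x, hxS⟩
      rw [Finset.card_erase_of_mem hxS]
      exact Nat.Even.sub_odd h0 this odd_one
    have hB : ∀ B ∈ 𝓑.filter (fun B => x ∈ B), Odd (B ∩ S.erase x).card := by
      intro B hB
      have hxB : x ∈ B := (Finset.mem_filter.1 hB).2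
      have h0 : 0 < (B ∩ S).card := Finset.card_pos.2 ⟨x, by simp [hxB, hxS]⟩
      rw [Finset.inter_erase, Finset.card_erase_of_mem (by simp [hxB, hxS])]
      exact Nat.Even.sub_odd h0 (hall B hB) odd_one
    rw [← hsum, Finset.odd_sum_iff_odd_card_odd, Finset.filter_true_of_mem hB] at hodd
    exact Nat.not_even_iff_odd.2 hodd (hEven x)
  · rw [Finset.erase_eq_of_notMem hxS] at hsum
    refine hxS (hx.2 ?_)
    rw [← hsum]
    exact Finset.even_sum _ fun B hB => hall B hB

/-- A lower bound for the weight of a sum of evenly many rows of the extended matrix. The four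
double counts give, for `s = |S|` and `o` odd blocks, `o ≥ s (r + 1 - s)` and `3 o ≥ s` if `s` is
even, and `2 o ≥ v - s` and `3 o ≥ s (r - (v - s))` if `s` is odd. -/
lemma IsSteiner2.le_card_add_card_oddBlocks (hS : IsSteiner2 3 𝓑) (hEven : IsEvenReplicate 𝓑)
    {r d : ℕ} (hr4 : 4 ≤ r) (hv : Fintype.card V = 2 * r + 1)
    (hr : ∀ x : V, (𝓑.filter (fun B => x ∈ B)).card = r) (hre : Even r)
    (hd : 7 * d ≤ 4 * (Fintype.card V + 3)) {S : Finset V} (hne : S.Nonempty) :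
    d ≤ (Finset.univ.filter fun x => x ∈ S ↔ Even S.card).card + (oddBlocks 𝓑 S).card := by
  have hcard3 : ∀ B ∈ oddBlocks 𝓑 S, B.card = 3 := fun B hB =>
    hS.card_mem B (Finset.mem_filter.1 hB).1
  have hpoint : ∀ (x : V), (x ∈ S ↔ Even S.card) →
      1 ≤ (Finset.bipartiteAbove (fun x B => x ∈ B) (oddBlocks 𝓑 S) x).card := by
    intro x hx
    obtain ⟨B, hB, hxB⟩ := hS.exists_mem_oddBlocks hEven hx
    exact Finset.card_pos.2 ⟨B, by simp [Finset.bipartiteAbove, hB, hxB]⟩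
  have hpos : 0 < S.card := hne.card_pos
  have hle : S.card ≤ Fintype.card V := Finset.card_le_univ S
  have hbelow : ∀ B ∈ oddBlocks 𝓑 S,
      (Finset.bipartiteBelow (fun x B => x ∈ B) S B).card ≤ 3 := by
    intro B hB
    rw [← hcard3 B hB]
    exact Finset.card_le_card fun y hy => (Finset.mem_filter.1 hy).2
  by_cases hSe : Even S.card
  · have hU : (Finset.univ.filter fun x => x ∈ S ↔ Even S.card) = S := by
      ext x
      simp [hSe]
    rw [hU]
    have h3 : S.card * 1 ≤ (oddBlocks 𝓑 S).card * 3 :=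
      Finset.card_mul_le_card_mul (fun x B => x ∈ B)
        (fun x hx => hpoint x (by simp [hx, hSe])) hbelow
    have h1 : S.card * (r - (S.card - 1)) ≤ (oddBlocks 𝓑 S).card := by
      have h := Finset.card_mul_le_card_mul (s := S) (n := 1)
        (t := (oddBlocks 𝓑 S).filter fun B => (B ∩ S).card = 1) (m := r - (S.card - 1))
        (fun x B => x ∈ B) ?_ ?_
      · rw [mul_one] at h
        exact h.trans (Finset.card_filter_le _ _)
      · intro x hx
        have h := hS.replication_sub_le (x := x) (Y := S.erase x) (by simp)
        rw [hr x, Finset.card_erase_of_mem hx] at h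
        refine h.trans (Finset.card_le_card fun B hB => ?_)
        rw [Finset.mem_filter] at hB
        have hBS : B ∩ S = {x} := by
          ext y
          rw [Finset.mem_inter, Finset.mem_singleton]
          refine ⟨fun hy => ?_, fun hy => hy ▸ ⟨hB.2.1, hx⟩⟩
          by_contra hyx
          exact Finset.disjoint_left.1 hB.2.2 hy.1 (by simp [hyx, hy.2])
        simp [Finset.bipartiteAbove, oddBlocks, hBS, hB.1, hB.2.1]
      · intro B hB
        rw [← (Finset.mem_filter.1 hB).2]
        refine Finset.card_le_card fun y hy => ?_
        have := Finset.mem_filter.1 hy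
        simp [this.1, this.2]
    generalize S.card = s at *
    generalize (oddBlocks 𝓑 S).card = o at *
    obtain ⟨m, rfl⟩ := hSe
    obtain ⟨k, rfl⟩ := hre
    -- For `s ≤ r` the bound `o ≥ s (r + 1 - s)` gives weight at least `2 r`; otherwise
    -- `s ≥ r + 2`, and `3 o ≥ s` gives weight at least `4 (r + 2) / 3`.
    by_cases hmk : m ≤ k
    · obtain ⟨j, rfl⟩ := Nat.exists_eq_add_of_le hmk
      have h5 : m + j + (m + j) - (m + m - 1) = 2 * j + 1 := by omega
      rw [h5] at h1
      obtain ⟨n, rfl⟩ : ∃ n, m = n + 1 := ⟨m - 1, by omega⟩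
      nlinarith [Nat.zero_le (n * j)]
    · omega
  · have hU : (Finset.univ.filter fun x => x ∈ S ↔ Even S.card) = Sᶜ := by
      ext x
      simp [hSe]
    rw [hU]
    have hodd := Nat.not_even_iff_odd.1 hSe
    have h2 : Sᶜ.card * 1 ≤ (oddBlocks 𝓑 S).card * 2 := by
      refine Finset.card_mul_le_card_mul (fun x B => x ∈ B)
        (fun x hx => hpoint x (by simpa [hSe] using hx)) fun B hB => ?_
      have h0 : 0 < (B ∩ S).card := (Finset.mem_filter.1 hB).2.pos
      have h4 : (Finset.bipartiteBelow (fun x B => x ∈ B) Sᶜ B) = B \ S := by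
        ext y
        simp [Finset.bipartiteBelow, and_comm]
      have := Finset.card_sdiff_add_card_inter B S
      rw [h4]
      rw [hcard3 B hB] at this
      omega
    have h3 : S.card * (r - Sᶜ.card) ≤ (oddBlocks 𝓑 S).card * 3 := by
      refine Finset.card_mul_le_card_mul (fun x B => x ∈ B) (fun x hx => ?_) hbelow
      have h := hS.replication_sub_le (x := x) (Y := Sᶜ) (by simpa using hx)
      rw [hr x] at h
      refine h.trans (Finset.card_le_card fun B hB => ?_)
      rw [Finset.mem_filter] at hB
      have hBS : B ∩ S = B :=
        Finset.inter_eq_left.2 (disjoint_compl_right_iff.1 hB.2.2)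
      have h3 : B.card = 3 := hS.card_mem B hB.1
      simp [Finset.bipartiteAbove, oddBlocks, hBS, hB.1, hB.2.1, h3, show Odd 3 by decide]
    have hc : Sᶜ.card = Fintype.card V - S.card := Finset.card_compl S
    generalize Sᶜ.card = t at *
    generalize S.card = s at *
    generalize (oddBlocks 𝓑 S).card = o at *
    -- With `t = v - s`: for `t ≥ r` the bound `2 o ≥ t` gives weight at least `3 r / 2`; otherwise
    -- `t ≤ r - 2` by parity, and `3 o ≥ s (r - t)` gives weight at least `5 r / 3`.
    by_cases htr : r ≤ t
    · omega
    · obtain ⟨k, rfl⟩ := Nat.exists_eq_add_of_lt (not_le.1 htr)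
      obtain ⟨m, rfl⟩ := hodd
      obtain ⟨j, hj⟩ := hre
      obtain ⟨l, rfl⟩ : ∃ l, k = l + 1 := ⟨k - 1, by omega⟩
      have h5 : t + (l + 1) + 1 - t = l + 2 := by omega
      have h6 : 2 * m + 1 = t + 2 * l + 5 := by omega
      rw [h5, h6] at h3
      nlinarith [Nat.zero_le (t * l), Nat.zero_le (l * l)]

end TripleSystem

/-! ### Pauli operators -/

section PauliOperators

variable {ι κ : Type*} [Fintype ι] [Fintype κ]

lemma neg_one_pow_val_add (a b : ZMod 2) :
    (-1 : ℂ) ^ (a + b).val = (-1) ^ a.val * (-1) ^ b.val := by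
  rw [ZMod.val_add, ← neg_one_pow_eq_pow_mod_two, pow_add]

lemma pauliOp_apply (p : Pauli ι) (ψ : QState ι) (y : ι → ZMod 2) :
    pauliOp p ψ y = (-1 : ℂ) ^ (p.2 ⬝ᵥ (y + p.1)).val * ψ (y + p.1) := rfl

lemma pauliOp_mul (p q : Pauli ι) :
    pauliOp p * pauliOp q = (-1 : ℂ) ^ (p.2 ⬝ᵥ q.1).val • pauliOp (p + q) := by
  refine LinearMap.ext fun ψ => funext fun y => ?_
  simp only [Module.End.mul_apply, LinearMap.smul_apply, Pi.smul_apply, smul_eq_mul,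
    pauliOp_apply, Prod.fst_add, Prod.snd_add]
  have h : p.2 ⬝ᵥ (y + p.1) + q.2 ⬝ᵥ (y + p.1 + q.1) =
      p.2 ⬝ᵥ q.1 + (p.2 + q.2) ⬝ᵥ (y + (p.1 + q.1)) := by
    simp only [dotProduct_add, add_dotProduct]
    linear_combination (-(p.2 ⬝ᵥ q.1)) * (CharTwo.two_eq_zero : (2 : ZMod 2) = 0)
  rw [← mul_assoc, ← neg_one_pow_val_add, h, neg_one_pow_val_add, mul_assoc, add_assoc]

lemma pauliOp_zero : pauliOp (0 : Pauli ι) = 1 := by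
  refine LinearMap.ext fun ψ => funext fun y => ?_
  simp [pauliOp_apply]

lemma pauliOp_mul_self (p : Pauli ι) :
    pauliOp p * pauliOp p = (-1 : ℂ) ^ (p.2 ⬝ᵥ p.1).val • 1 := by
  have h : p + p = 0 :=
    Prod.ext (funext fun i => CharTwo.add_self_eq_zero (p.1 i))
      (funext fun i => CharTwo.add_self_eq_zero (p.2 i))
  rw [pauliOp_mul, h, pauliOp_zero]

lemma pauliOp_mul_comm (p q : Pauli ι) :
    pauliOp p * pauliOp q = (-1 : ℂ) ^ (symp p q).val • (pauliOp q * pauliOp p) := by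
  have h : p.2 ⬝ᵥ q.1 = symp p q + q.2 ⬝ᵥ p.1 := by
    rw [symp, dotProduct_comm p.1 q.2]
    linear_combination (-(q.2 ⬝ᵥ p.1)) * (CharTwo.two_eq_zero : (2 : ZMod 2) = 0)
  rw [pauliOp_mul, pauliOp_mul, smul_smul, ← neg_one_pow_val_add, ← h, add_comm p q]

lemma pauliOp_ne_zero_of_ne_zero (p : Pauli ι) {ψ : QState ι} (hψ : ψ ≠ 0) :
    pauliOp p ψ ≠ 0 := by
  intro h
  have h2 := LinearMap.congr_fun (pauliOp_mul_self p) ψ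
  rw [Module.End.mul_apply, h, map_zero, LinearMap.smul_apply, Module.End.one_apply] at h2
  exact hψ ((smul_eq_zero.1 h2.symm).resolve_left (pow_ne_zero _ (by norm_num)))

lemma symp_tensor (p q : Pauli ι) (p' q' : Pauli κ) :
    symp (p.tensor p') (q.tensor q') = symp p q + symp p' q' := by
  simp only [symp, Pauli.tensor, sumElim_dotProduct_sumElim]
  ring

lemma symp_zero_left (q : Pauli ι) : symp 0 q = 0 := by
  simp [symp]

lemma symp_comm (p q : Pauli ι) : symp p q = symp q p := by
  rw [symp, symp, dotProduct_comm p.1, dotProduct_comm p.2, add_comm]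

lemma symp_sum_smul_left {α : Type*} (s : Finset α) (l : α → ZMod 2) (p : α → Pauli ι)
    (q : Pauli ι) : symp (∑ i ∈ s, l i • p i) q = ∑ i ∈ s, l i * symp (p i) q := by
  simp only [symp, Prod.fst_sum, Prod.snd_sum, sum_dotProduct, Prod.smul_fst, Prod.smul_snd,
    smul_dotProduct, smul_eq_mul, ← Finset.sum_add_distrib, mul_add]

/-- The symplectic form is nondegenerate: every linear functional is a pairing with a Pauli
operator. -/
lemma exists_symp_eq (φ : Pauli ι →ₗ[ZMod 2] ZMod 2) : ∃ F : Pauli ι, ∀ p, φ p = symp p F := by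
  classical
  refine ⟨(fun i => φ (0, Pi.single i 1), fun i => φ (Pi.single i 1, 0)), fun p => ?_⟩
  have hs : ∀ i : ι, (fun j => if i = j then (1 : ZMod 2) else 0) = Pi.single i 1 := by
    intro i
    ext j
    simp [Pi.single_apply, eq_comm]
  have h1 : φ (p.1, 0) = ∑ i, p.1 i * φ (Pi.single i 1, 0) := by
    have := LinearMap.pi_apply_eq_sum_univ (φ.comp (LinearMap.inl (ZMod 2) _ _)) p.1
    simpa only [hs, LinearMap.comp_apply, LinearMap.inl_apply, LinearMap.inr_apply, smul_eq_mul]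
      using this
  have h2 : φ (0, p.2) = ∑ i, p.2 i * φ (0, Pi.single i 1) := by
    have := LinearMap.pi_apply_eq_sum_univ (φ.comp (LinearMap.inr (ZMod 2) _ _)) p.2
    simpa only [hs, LinearMap.comp_apply, LinearMap.inl_apply, LinearMap.inr_apply, smul_eq_mul]
      using this
  rw [symp, dotProduct, dotProduct, ← h1, ← h2, ← map_add]
  simp

end PauliOperators

/-! ### Entanglement-assisted codes -/

section EACode

variable {κ N : Type*} [Fintype κ] [Fintype N] {g : κ → Pauli N} {c : ℕ}
  {Q : Submodule ℂ (QState (N ⊕ Fin c))}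

/-- For the extended operators `(g i).tensor (e i)` of a code: they commute pairwise, and every
Pauli operator that commutes with all of them preserves the code space. -/
lemma IsEACode.exists_extension (hQ : IsEACode g c Q) :
    ∃ e : κ → Pauli (Fin c),
      (∀ i j, symp ((g i).tensor (e i)) ((g j).tensor (e j)) = 0) ∧
      ∀ F : Pauli (N ⊕ Fin c), (∀ i, symp ((g i).tensor (e i)) F = 0) →
        ∀ ψ ∈ Q, pauliOp F ψ ∈ Q := by
  obtain ⟨e, phase, s, hs, hinv, hcomm, rfl⟩ := hQ.stabilized
  obtain ⟨ψ, -, hψ⟩ := Submodule.exists_mem_ne_zero_of_ne_bot hQ.ne_bot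
  have hphase : ∀ i, phase i ≠ 0 := by
    intro i h
    have := LinearMap.congr_fun (hinv i) ψ
    rw [hs, h, zero_smul, zero_mul] at this
    exact hψ this.symm
  refine ⟨e, fun i j => ?_, fun F hF φ hφ => ?_⟩
  · have h1 : pauliOp ((g i).tensor (e i)) * pauliOp ((g j).tensor (e j)) =
        pauliOp ((g j).tensor (e j)) * pauliOp ((g i).tensor (e i)) := by
      have h := (hcomm i j).eq
      rw [hs, hs, smul_mul_smul_comm, smul_mul_smul_comm, mul_comm (phase j)] at h
      exact smul_right_injective _ (mul_ne_zero (hphase i) (hphase j)) h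
    have h2 := LinearMap.congr_fun (pauliOp_mul_comm ((g i).tensor (e i)) ((g j).tensor (e j))) ψ
    rw [h1, LinearMap.smul_apply, Module.End.mul_apply] at h2
    have h3 := pauliOp_ne_zero_of_ne_zero ((g j).tensor (e j))
      (pauliOp_ne_zero_of_ne_zero ((g i).tensor (e i)) hψ)
    revert h2
    generalize symp ((g i).tensor (e i)) ((g j).tensor (e j)) = a
    intro h2
    fin_cases a
    · rfl
    · refine absurd (self_eq_neg.1 (h2.trans ?_)) h3
      change (-1 : ℂ) ^ 1 • _ = _
      rw [pow_one, neg_one_smul]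
  · rw [Submodule.mem_iInf] at hφ ⊢
    intro i
    have h := hφ i
    rw [Module.End.mem_eigenspace_iff, one_smul] at h ⊢
    have h2 : s i * pauliOp F = pauliOp F * s i := by
      rw [hs, smul_mul_assoc, pauliOp_mul_comm, hF i, ZMod.val_zero, pow_zero, one_smul,
        mul_smul_comm]
    rw [← Module.End.mul_apply, h2, Module.End.mul_apply, h]

/-- A Pauli operator that acts trivially is, up to phase, a product of extended operators.
Otherwise some Pauli operator `F` would commute with all extended operators but anticommute with
it; as `F` preserves the code space, the scalar would equal its own negative. -/
lemma mem_span_of_actsTrivially {κ : Type*} {g : κ → Pauli N} {e : κ → Pauli (Fin c)} (hne : Q ≠ ⊥)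
    (he : ∀ F : Pauli (N ⊕ Fin c), (∀ i, symp ((g i).tensor (e i)) F = 0) →
        ∀ ψ ∈ Q, pauliOp F ψ ∈ Q)
    {E : Pauli N} (hE : ActsTrivially Q E) :
    E.tensor 0 ∈ Submodule.span (ZMod 2) (Set.range fun i => (g i).tensor (e i)) := by
  by_contra hmem
  obtain ⟨φ, hφE, hφ⟩ := Submodule.exists_le_ker_of_notMem hmem
  obtain ⟨F, hF⟩ := exists_symp_eq φ
  obtain ⟨t, ht⟩ := hE
  obtain ⟨ψ, hψQ, hψ⟩ := Submodule.exists_mem_ne_zero_of_ne_bot hne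
  have hFQ := he F (fun i => by
    rw [← hF]
    exact hφ (Submodule.subset_span ⟨i, rfl⟩)) ψ hψQ
  have h1 : symp (E.tensor (0 : Pauli (Fin c))) F = 1 := by
    rw [← hF]
    revert hφE
    generalize φ (E.tensor 0) = a
    revert a
    decide
  have h2 := LinearMap.congr_fun (pauliOp_mul_comm (E.tensor (0 : Pauli (Fin c))) F) ψ
  have h3 : pauliOp (E.tensor (0 : Pauli (Fin c))) ψ = t • ψ := ht ψ hψQ
  have h4 : pauliOp (E.tensor (0 : Pauli (Fin c))) (pauliOp F ψ) = t • pauliOp F ψ := ht _ hFQ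
  have h5 : (-1 : ℂ) ^ (ZMod.val (1 : ZMod 2)) = -1 := by simp [ZMod.val_one]
  rw [h1, h5, LinearMap.smul_apply, Module.End.mul_apply, Module.End.mul_apply, h3, h4, map_smul,
    neg_one_smul, self_eq_neg] at h2
  have h6 := pauliOp_ne_zero_of_ne_zero (E.tensor (0 : Pauli (Fin c))) hψ
  have ht0 : t = 0 := (smul_eq_zero.1 h2).resolve_right (pauliOp_ne_zero_of_ne_zero F hψ)
  exact h6 (by rw [h3, ht0, zero_smul])

/-- A Pauli operator that acts trivially is, up to phase, a product of the operators `g i` that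
commutes with each of them, because the product of the extensions to the ebits is trivial. -/
lemma IsEACode.exists_sum_of_actsTrivially (hQ : IsEACode g c Q) {E : Pauli N}
    (hE : ActsTrivially Q E) :
    ∃ l : κ → ZMod 2, E = ∑ i, l i • g i ∧ ∀ j, ∑ i, l i * symp (g i) (g j) = 0 := by
  obtain ⟨e, hcomm, he⟩ := hQ.exists_extension
  obtain ⟨l, hl⟩ := (Submodule.mem_span_range_iff_exists_fun _).1
    (mem_span_of_actsTrivially hQ.ne_bot he hE)
  have hEl : E = ∑ i, l i • g i := by
    refine Prod.ext (funext fun x => ?_) (funext fun x => ?_)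
    · have := congrFun (congrArg Prod.fst hl) (Sum.inl x)
      simpa [Pauli.tensor, Prod.fst_sum] using this.symm
    · have := congrFun (congrArg Prod.snd hl) (Sum.inl x)
      simpa [Pauli.tensor, Prod.snd_sum] using this.symm
  have h0 : ∑ i, l i • e i = 0 := by
    refine Prod.ext (funext fun x => ?_) (funext fun x => ?_)
    · have := congrFun (congrArg Prod.fst hl) (Sum.inr x)
      simpa [Pauli.tensor, Prod.fst_sum] using this
    · have := congrFun (congrArg Prod.snd hl) (Sum.inr x)
      simpa [Pauli.tensor, Prod.snd_sum] using this
  refine ⟨l, hEl, fun j => ?_⟩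
  have h1 : ∑ i, l i * symp (e i) (e j) = 0 := by
    rw [← symp_sum_smul_left, h0, symp_zero_left]
  rw [← h1]
  refine Finset.sum_congr rfl fun i _ => ?_
  have h2 := hcomm i j
  rw [symp_tensor] at h2
  rw [CharTwo.add_eq_zero.1 h2]

/-- An error that commutes with all operators `g i` is undetectable. -/
lemma IsEACode.undetectable (hQ : IsEACode g c Q) {E : Pauli N} (hE : ∀ i, symp (g i) E = 0) :
    Undetectable Q E := by
  obtain ⟨e, -, he⟩ := hQ.exists_extension
  refine he _ fun i => ?_
  rw [symp_tensor, hE, symp_comm, symp_zero_left, add_zero]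

end EACode

/-! ### The code of the extended incidence matrix -/

section ExtendedMatrix

lemma hammingNorm_sumElim {α β : Type*} [Fintype α] [Fintype β] (f : α → ZMod 2)
    (h : β → ZMod 2) : hammingNorm (Sum.elim f h) = hammingNorm f + hammingNorm h := by
  simp only [hammingNorm, Finset.card_filter, Fintype.sum_sum_type, Sum.elim_inl, Sum.elim_inr]
  rfl

lemma hammingNorm_fst_le_pauliWeight {N : Type*} [Fintype N] (E : Pauli N) :
    hammingNorm E.1 ≤ pauliWeight E :=
  Finset.card_le_card fun i hi => by
    simp only [Finset.mem_filter, Finset.mem_univ, true_and] at hi ⊢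
    exact Or.inl hi

lemma hammingNorm_snd_le_pauliWeight {N : Type*} [Fintype N] (E : Pauli N) :
    hammingNorm E.2 ≤ pauliWeight E :=
  Finset.card_le_card fun i hi => by
    simp only [Finset.mem_filter, Finset.mem_univ, true_and] at hi ⊢
    exact Or.inr hi

variable {V : Type*} [Fintype V] [DecidableEq V] {𝓑 : Finset (Finset V)}

lemma vecMul_extendedMatrix {β : Type*} (H : Matrix V β (ZMod 2)) (f : V → ZMod 2)
    (η : Unit → ZMod 2) :
    Sum.elim f η ᵥ* extendedMatrix H = Sum.elim (fun x => f x + η ()) (f ᵥ* H) := by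
  rw [extendedMatrix, Matrix.vecMul_fromBlocks, Matrix.vecMul_one, Matrix.vecMul_zero, add_zero]
  congr 1
  funext x
  simp [Matrix.vecMul, dotProduct]

lemma sum_eq_card_filter_ne_zero {α : Type*} (s : Finset α) (f : α → ZMod 2) :
    ∑ x ∈ s, f x = (s.filter fun x => f x ≠ 0).card := by
  rw [Finset.card_filter, Nat.cast_sum]
  refine Finset.sum_congr rfl fun x _ => ?_
  generalize f x = a
  revert a
  decide

lemma vecMul_incidenceMatrix_apply (f : V → ZMod 2) (B : 𝓑) :
    (f ᵥ* incidenceMatrix 𝓑) B = ∑ x ∈ (B : Finset V), f x := by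
  simp [Matrix.vecMul, dotProduct, incidenceMatrix]

/-- The inner product of two rows of `H'` is always `1`: two points share one block, and a point
lies in an even number of blocks. -/
lemma IsSteiner2.extendedMatrix_dotProduct (hS : IsSteiner2 3 𝓑) (hEven : IsEvenReplicate 𝓑)
    (i j : V ⊕ Unit) :
    extendedMatrix (incidenceMatrix 𝓑) i ⬝ᵥ extendedMatrix (incidenceMatrix 𝓑) j = 1 := by
  obtain ⟨x₀⟩ := hS.nonempty
  have hrow : ∀ x : V, extendedMatrix (incidenceMatrix 𝓑) (Sum.inl x) =
      Sum.elim (Pi.single x 1) (incidenceMatrix 𝓑 x) := by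
    intro x
    funext k
    rcases k with k | k
    · simp [extendedMatrix, Matrix.one_apply, Pi.single_apply, eq_comm]
    · rfl
  have hlast : extendedMatrix (incidenceMatrix 𝓑) (Sum.inr ()) =
      Sum.elim (1 : V → ZMod 2) (0 : 𝓑 → ZMod 2) := by
    funext k
    rcases k with k | k <;> rfl
  have hinc : ∀ x y : V, incidenceMatrix 𝓑 x ⬝ᵥ incidenceMatrix 𝓑 y =
      ((𝓑.filter fun B => x ∈ B ∧ y ∈ B).card : ZMod 2) := by
    intro x y
    simp only [dotProduct, incidenceMatrix, Matrix.of_apply]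
    rw [Finset.card_filter, Nat.cast_sum, ← Finset.sum_coe_sort 𝓑]
    refine Finset.sum_congr rfl fun B _ => ?_
    by_cases hx : x ∈ (B : Finset V) <;> by_cases hy : y ∈ (B : Finset V) <;> simp [hx, hy]
  rcases i with x | u <;> rcases j with y | w
  · rw [hrow, hrow, sumElim_dotProduct_sumElim, hinc, single_one_dotProduct]
    by_cases hxy : x = y
    · subst hxy
      simp only [and_self, Pi.single_eq_same]
      rw [(ZMod.natCast_eq_zero_iff_even).2 (hEven x), add_zero]
    · rw [hS.card_filter_mem_mem hxy, Pi.single_eq_of_ne hxy]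
      simp
  · rw [hrow, hlast, sumElim_dotProduct_sumElim, single_one_dotProduct]
    simp
  · rw [hrow, hlast, sumElim_dotProduct_sumElim, dotProduct_single_one]
    simp
  · have hodd : Odd (Fintype.card V) := by
      rw [← hS.two_mul_replication_add_one x₀]
      exact odd_two_mul_add_one _
    rw [hlast, sumElim_dotProduct_sumElim]
    simpa [dotProduct] using (ZMod.natCast_eq_one_iff_odd).2 hodd

/-- The rows of `H'` have pairwise inner product `1`, so a product of check operators commutes
with all of them only if it has an even number of factors of either type. -/
lemma IsSteiner2.exists_vecMul_of_actsTrivially (hS : IsSteiner2 3 𝓑)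
    (hEven : IsEvenReplicate 𝓑) {c : ℕ} {Q : Submodule ℂ (QState ((V ⊕ 𝓑) ⊕ Fin c))}
    (hQ : IsEACode (quantumCheckRows (extendedMatrix (incidenceMatrix 𝓑))) c Q)
    {E : Pauli (V ⊕ 𝓑)} (hE : ActsTrivially Q E) :
    (∃ f : V → ZMod 2, E.1 = Sum.elim (fun x => f x + ∑ y, f y) (f ᵥ* incidenceMatrix 𝓑)) ∧
      ∃ f : V → ZMod 2, E.2 = Sum.elim (fun x => f x + ∑ y, f y) (f ᵥ* incidenceMatrix 𝓑) := by
  obtain ⟨l, hl, h0⟩ := hQ.exists_sum_of_actsTrivially hE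
  have key : ∀ k : V ⊕ Unit → ZMod 2, ∑ i, k i = 0 →
      ∃ f : V → ZMod 2, k ᵥ* extendedMatrix (incidenceMatrix 𝓑) =
        Sum.elim (fun x => f x + ∑ y, f y) (f ᵥ* incidenceMatrix 𝓑) := by
    intro k hk
    refine ⟨k ∘ Sum.inl, ?_⟩
    rw [← vecMul_extendedMatrix _ (k ∘ Sum.inl) fun _ => ∑ y, (k ∘ Sum.inl) y]
    congr 1
    funext i
    rcases i with x | ⟨⟩
    · rfl
    · have hk' : ∑ x, k (Sum.inl x) + k (Sum.inr ()) = 0 := by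
        simpa [Fintype.sum_sum_type] using hk
      exact (CharTwo.add_eq_zero.1 hk').symm
  constructor
  · have hk := h0 (Sum.inr (Sum.inr ()))
    obtain ⟨f, hf⟩ := key (l ∘ Sum.inl) (by
      simpa [Fintype.sum_sum_type, quantumCheckRows, symp,
        hS.extendedMatrix_dotProduct hEven] using hk)
    refine ⟨f, ?_⟩
    rw [← hf, hl]
    funext x
    simp [Fintype.sum_sum_type, quantumCheckRows, Matrix.vecMul, dotProduct, Prod.fst_sum]
  · have hk := h0 (Sum.inl (Sum.inr ()))
    obtain ⟨f, hf⟩ := key (l ∘ Sum.inr) (by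
      simpa [Fintype.sum_sum_type, quantumCheckRows, symp,
        hS.extendedMatrix_dotProduct hEven] using hk)
    refine ⟨f, ?_⟩
    rw [← hf, hl]
    funext x
    simp [Fintype.sum_sum_type, quantumCheckRows, Matrix.vecMul, dotProduct, Prod.snd_sum]

/-- The sum of the rows of `H'` indexed by the support `S` of `f`, with the last row added if
`|S|` is odd, is supported on the points of `S`, or of its complement if `|S|` is odd, and on the
blocks that meet `S` in an odd number of points. -/
lemma hammingNorm_vecMul_extendedMatrix (f : V → ZMod 2) {S : Finset V}
    (hSf : S = Finset.univ.filter fun x => f x ≠ 0) :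
    hammingNorm (Sum.elim (fun x => f x + ∑ y, f y) (f ᵥ* incidenceMatrix 𝓑)) =
      (Finset.univ.filter fun x => x ∈ S ↔ Even S.card).card + (oddBlocks 𝓑 S).card := by
  have hη : ∑ y, f y = S.card := by rw [sum_eq_card_filter_ne_zero, hSf]
  rw [hammingNorm_sumElim]
  congr 1
  · refine congrArg Finset.card (Finset.filter_congr fun x _ => ?_)
    have hx : x ∈ S ↔ f x ≠ 0 := by simp [hSf]
    change f x + _ ≠ 0 ↔ _
    rw [hx, ← ZMod.natCast_eq_zero_iff_even, ← hη]
    generalize f x = a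
    generalize ∑ y, f y = b
    revert a b
    decide
  · rw [oddBlocks, Finset.card_filter, hammingNorm, Finset.card_filter, ← Finset.sum_coe_sort 𝓑]
    refine Finset.sum_congr rfl fun B _ => if_congr ?_ rfl rfl
    rw [vecMul_incidenceMatrix_apply, sum_eq_card_filter_ne_zero, ZMod.natCast_ne_zero_iff_odd,
      hSf]
    simp [Finset.inter_filter]

/-- The minimum distance `d` of the code of the incidence matrix does not exceed the weight of
any nonzero sum of evenly many rows of `H'`. -/
lemma IsSteiner2.le_hammingNorm (hS : IsSteiner2 3 𝓑) (hEven : IsEvenReplicate 𝓑) {d r : ℕ}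
    (hr4 : 4 ≤ r) (hv : Fintype.card V = 2 * r + 1)
    (hr : ∀ x : V, (𝓑.filter (fun B => x ∈ B)).card = r) (hre : Even r)
    (hd : 7 * d ≤ 4 * (Fintype.card V + 3)) (f : V → ZMod 2)
    (hne : Sum.elim (fun x => f x + ∑ y, f y) (f ᵥ* incidenceMatrix 𝓑) ≠ 0) :
    d ≤ hammingNorm (Sum.elim (fun x => f x + ∑ y, f y) (f ᵥ* incidenceMatrix 𝓑)) := by
  rw [hammingNorm_vecMul_extendedMatrix f rfl]
  refine hS.le_card_add_card_oddBlocks hEven hr4 hv hr hre hd ?_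
  by_contra hempty
  have hf : f = 0 := by
    funext x
    by_contra hx
    exact hempty ⟨x, by simpa using hx⟩
  refine hne (funext fun i => ?_)
  rcases i with x | B <;> simp [hf]

/-- A word `w` of minimum weight of the code of the incidence matrix gives the error `X^(0, w)`.
It commutes with the check operators, and it could act trivially only if `w` were the all-one
word, whose weight is too large. -/
lemma IsSteiner2.exists_undetectable (hS : IsSteiner2 3 𝓑) (hEven : IsEvenReplicate 𝓑) {d : ℕ}
    (hd : HasMinDist (codeOf (incidenceMatrix 𝓑)) d)
    (hdb : d < 𝓑.card) {c : ℕ} {Q : Submodule ℂ (QState ((V ⊕ 𝓑) ⊕ Fin c))}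
    (hQ : IsEACode (quantumCheckRows (extendedMatrix (incidenceMatrix 𝓑))) c Q) :
    ∃ E : Pauli (V ⊕ 𝓑), Undetectable Q E ∧ ¬ ActsTrivially Q E ∧ pauliWeight E = d := by
  obtain ⟨w, hw, hw0, hwd⟩ := hd.1
  rw [codeOf, LinearMap.mem_ker, Matrix.mulVecLin_apply] at hw
  have hnorm : hammingNorm (Sum.elim (0 : V → ZMod 2) w) = d := by
    rw [hammingNorm_sumElim, hammingNorm_zero, zero_add, hwd]
  refine ⟨(Sum.elim 0 w, 0), hQ.undetectable fun i => ?_, fun htriv => ?_, ?_⟩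
  · rcases i with (x | u) | i
    · simp [symp, quantumCheckRows]
    · simp [symp, quantumCheckRows]
    · have h : extendedMatrix (incidenceMatrix 𝓑) *ᵥ Sum.elim 0 w = 0 := by
        rw [extendedMatrix, Matrix.fromBlocks_mulVec]
        funext k
        rcases k with k | k <;> simp [hw]
      have := congrFun h i
      simpa [symp, quantumCheckRows, Matrix.mulVec] using this
  · obtain ⟨f, hf⟩ := (hS.exists_vecMul_of_actsTrivially hEven hQ htriv).1
    have hconst : ∀ x, f x = ∑ y, f y := fun x =>
      (CharTwo.add_eq_zero.1 (congrFun hf (Sum.inl x)).symm)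
    have hwB : ∀ B, w B = ∑ y, f y := by
      intro B
      have h1 : w B = (f ᵥ* incidenceMatrix 𝓑) B := congrFun hf (Sum.inr B)
      rw [h1, vecMul_incidenceMatrix_apply, Finset.sum_congr rfl fun x _ => hconst x,
        Finset.sum_const, show (B : Finset V).card = 3 from hS.card_mem B B.2]
      generalize ∑ y, f y = a
      revert a
      decide
    have hne : ∑ y, f y ≠ 0 := fun h => hw0 (funext fun B => by rw [hwB, h]; rfl)
    have hall : hammingNorm w = 𝓑.card := by
      rw [hammingNorm, Finset.filter_true_of_mem fun B _ => by rw [hwB]; exact hne,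
        Finset.card_univ, Fintype.card_coe]
    omega
  · rw [← hnorm]
    simp [pauliWeight, hammingNorm]

end ExtendedMatrix

/-! ### Existence of the code -/

section Existence

/-- If the rows of a binary matrix have pairwise inner product `1`, then a single ebit suffices: its
half is acted on by `X` for every check of type `X` and by `Z` for every check of type `Z`, and the
indicator function of the span of the extended rows is a common fixed vector. -/
lemma exists_isEACode_of_dotProduct_eq_one {M N : Type*} [Fintype M] [Nonempty M] [Fintype N]
    {H : Matrix M N (ZMod 2)} (hH : ∀ i j, H i ⬝ᵥ H j = 1) :
    ∃ (c : ℕ) (Q : Submodule ℂ (QState (N ⊕ Fin c))), IsEACode (quantumCheckRows H) c Q := by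
  classical
  obtain ⟨i₀⟩ := ‹Nonempty M›
  let e : M ⊕ M → Pauli (Fin 1) := Sum.elim (fun _ => (1, 0)) (fun _ => (0, 1))
  let R : M → N ⊕ Fin 1 → ZMod 2 := fun i => Sum.elim (H i) 1
  have hR : ∀ i j, R i ⬝ᵥ R j = 0 := by
    intro i j
    rw [sumElim_dotProduct_sumElim, hH]
    simp only [dotProduct_one, Pi.one_apply, Finset.univ_unique, Finset.sum_singleton]
    decide
  have hX : ∀ i, (quantumCheckRows H (Sum.inl i)).tensor (e (Sum.inl i)) = (R i, 0) := by
    intro i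
    refine Prod.ext rfl (funext fun k => ?_)
    rcases k with k | k <;> rfl
  have hZ : ∀ i, (quantumCheckRows H (Sum.inr i)).tensor (e (Sum.inr i)) = (0, R i) := by
    intro i
    refine Prod.ext (funext fun k => ?_) rfl
    rcases k with k | k <;> rfl
  let s : M ⊕ M → Module.End ℂ (QState (N ⊕ Fin 1)) := fun i =>
    pauliOp ((quantumCheckRows H i).tensor (e i))
  refine ⟨1, ⨅ i, (s i).eigenspace 1, ?_, ⟨e, 1, s, ?_, ?_, ?_, rfl⟩, ?_⟩
  · -- The commutation matrix has all entries in the off-diagonal blocks equal to `1`; it factors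
    -- through the commutation matrix of `X` and `Z` on one qubit, and contains it.
    let P : Matrix (M ⊕ M) (Unit ⊕ Unit) (ZMod 2) :=
      Matrix.fromBlocks (Matrix.of fun _ _ => 1) 0 0 (Matrix.of fun _ _ => 1)
    let L : Matrix (Unit ⊕ Unit) (M ⊕ M) (ZMod 2) :=
      Matrix.fromBlocks (Matrix.of fun _ j => if j = i₀ then 1 else 0) 0 0
        (Matrix.of fun _ j => if j = i₀ then 1 else 0)
    let T : Matrix (Unit ⊕ Unit) (Unit ⊕ Unit) (ZMod 2) := Matrix.fromBlocks 0 1 1 0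
    have hT : T.rank = 2 := by
      have hTT : T * T = 1 := by
        simp [T, Matrix.fromBlocks_multiply]
      have := Matrix.rank_of_isUnit T (IsUnit.of_mul_eq_one T hTT)
      simpa using this
    have hG : (Matrix.of fun i j => symp (quantumCheckRows H i) (quantumCheckRows H j)) =
        P * T * Pᵀ := by
      ext i j
      rcases i with i | i <;> rcases j with j | j <;>
        simp [P, T, symp, quantumCheckRows, hH, Matrix.fromBlocks_multiply,
          Matrix.fromBlocks_transpose, Matrix.mul_apply]
    have hLP : L * P = 1 := by
      ext i j
      rcases i with i | i <;> rcases j with j | j <;>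
        simp [P, L, Matrix.mul_apply]
    rw [hG]
    refine le_antisymm ?_ ?_
    · calc (P * T * Pᵀ).rank ≤ (P * T).rank := Matrix.rank_mul_le_left _ _
        _ ≤ T.rank := Matrix.rank_mul_le_right _ _
        _ = 2 * 1 := hT
    · have hTG : L * (P * T * Pᵀ) * Lᵀ = T := by
        have : Pᵀ * Lᵀ = 1 := by rw [← Matrix.transpose_mul, hLP, Matrix.transpose_one]
        rw [Matrix.mul_assoc P, ← Matrix.mul_assoc L, hLP, Matrix.one_mul, Matrix.mul_assoc, this,
          Matrix.mul_one]
      calc 2 * 1 = T.rank := hT.symm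
        _ = (L * (P * T * Pᵀ) * Lᵀ).rank := by rw [hTG]
        _ ≤ (L * (P * T * Pᵀ)).rank := Matrix.rank_mul_le_left _ _
        _ ≤ (P * T * Pᵀ).rank := Matrix.rank_mul_le_right _ _
  · intro i
    rw [Pi.one_apply, one_smul]
  · intro i
    rcases i with i | i
    · simp only [s, hX, pauliOp_mul_self]
      simp
    · simp only [s, hZ, pauliOp_mul_self]
      simp
  · intro i j
    have h : symp ((quantumCheckRows H i).tensor (e i)) ((quantumCheckRows H j).tensor (e j)) =
        0 := by
      rcases i with i | i <;> rcases j with j | j <;> simp only [hX, hZ] <;> simp [symp, hR]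
    change _ * _ = _ * _
    simp only [s]
    rw [pauliOp_mul_comm, h, ZMod.val_zero, pow_zero, one_smul]
  · let W : Submodule (ZMod 2) (N ⊕ Fin 1 → ZMod 2) := Submodule.span (ZMod 2) (Set.range R)
    have hRW : ∀ i, R i ∈ W := fun i => Submodule.subset_span ⟨i, rfl⟩
    have hdot : ∀ i, ∀ y ∈ W, R i ⬝ᵥ y = 0 := by
      intro i y hy
      induction hy using Submodule.span_induction with
      | mem y hy =>
        obtain ⟨j, rfl⟩ := hy
        exact hR i j
      | zero => exact dotProduct_zero _
      | add y z _ _ hy hz => rw [dotProduct_add, hy, hz, add_zero]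
      | smul a y _ hy => rw [dotProduct_smul, hy, smul_zero]
    let ψ : QState (N ⊕ Fin 1) := fun y => if y ∈ W then 1 else 0
    have hψ : ψ ∈ ⨅ i, (s i).eigenspace 1 := by
      rw [Submodule.mem_iInf]
      intro i
      rw [Module.End.mem_eigenspace_iff, one_smul]
      funext y
      rcases i with i | i
      · simp only [s, hX, pauliOp_apply, ψ, W.add_mem_iff_left (hRW i)]
        simp
      · simp only [s, hZ, pauliOp_apply, ψ, add_zero]
        by_cases hy : y ∈ W
        · simp [hdot i y hy]
        · simp [hy]
    intro hbot
    rw [hbot, Submodule.mem_bot] at hψ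
    have := congrFun hψ 0
    simp [ψ] at this

end Existence

theorem mainTheorem4 {V : Type*} [Fintype V] [DecidableEq V] (𝓑 : Finset (Finset V)) (d : ℕ)
    (hS : IsSteiner2 3 𝓑) (hEven : IsEvenReplicate 𝓑)
    (hd : HasMinDist (codeOf (incidenceMatrix 𝓑)) d) :
    (∃ (c : ℕ) (Q : Submodule ℂ (QState ((V ⊕ 𝓑) ⊕ Fin c))),
      IsEACode (quantumCheckRows (extendedMatrix (incidenceMatrix 𝓑))) c Q) ∧
    ∀ (c : ℕ) (Q : Submodule ℂ (QState ((V ⊕ 𝓑) ⊕ Fin c))),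
      IsEACode (quantumCheckRows (extendedMatrix (incidenceMatrix 𝓑))) c Q →
      (∃ δ : ℕ, HasDistance Q δ ∧ δ ≤ d) ∧
      (HasDistance Q d →
        Fintype.card V ≠ 21 → Fintype.card V ≠ 33 → Fintype.card V ≠ 45 → ¬ IsDegenerate Q) := by
  refine ⟨exists_isEACode_of_dotProduct_eq_one (hS.extendedMatrix_dotProduct hEven),
    fun c Q hQ => ?_⟩
  -- The incidence matrix has a column, since its code contains a nonzero word.
  have hne : 𝓑.Nonempty := by
    obtain ⟨w, -, hw0, -⟩ := hd.1
    obtain ⟨B, -⟩ := Function.ne_iff.1 hw0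
    exact ⟨B, B.2⟩
  obtain ⟨r, hre, hr4, hv, hb, hr⟩ := hS.exists_replication hEven hne
  have h7 : 7 * d ≤ 4 * (Fintype.card V + 3) := hd.seven_mul_le (by rwa [Fintype.card_coe])
  have hmem := hS.exists_undetectable hEven hd (by omega) hQ
  refine ⟨⟨_, ⟨Nat.sInf_mem ⟨d, hmem⟩, fun _ h => Nat.sInf_le h⟩, Nat.sInf_le hmem⟩,
    fun hQd _ _ _ => ?_⟩
  rintro ⟨δ, hδ, E, hE0, hEδ, hE⟩
  rw [hδ.unique hQd] at hEδ
  obtain ⟨⟨f₁, hf₁⟩, f₂, hf₂⟩ := hS.exists_vecMul_of_actsTrivially hEven hQ hE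
  have hbound := hS.le_hammingNorm hEven hr4 hv hr hre h7
  have hX := hammingNorm_fst_le_pauliWeight E
  have hZ := hammingNorm_snd_le_pauliWeight E
  by_cases h1 : E.1 = 0
  · have h2 : E.2 ≠ 0 := fun h2 => hE0 (Prod.ext h1 h2)
    rw [hf₂] at h2 hZ
    have := hbound f₂ h2
    omega
  · rw [hf₁] at h1 hX
    have := hbound f₁ h1
    omega
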